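/- **Setting.** There are $N$ agents $a_1,\dots,a_N$ and $K$ arms $b_1,\dots,b_K$. Each arm $b_j$ has a strict total order $\succ_{b_j}$ over the agents. Each agent $a_i$ has a strict total order $\succ_{a_i}$ over the arms, represented by utilities $\mu_{i,j}$: $b_j\succ_{a_i}b_k$ iff $\mu_{i,j}>\mu_{i,k}$. Being matched is always better than being unmatched. Let $\Delta=\min_i\min_{j\neq k}|\mu_{i,j}-\mu_{i,k}|$. A matching $m$ is stable if there is no blocking pair, that is, no pair $(a_i,b_j)$ with $b_j\succ_{a_i}m(a_i)$ and $a_i\succ_{b_j}m(b_j)$. Let $\overline m$ (resp. $\underline m$) be the stable matching that every agent finds at least as good (resp. at most as good) as every other stable matching. For a matching $m$, let $ES_i(m)=\emptyset$ if $\{b_j : a_i\succ_{b_j}m(b_j)\}=\emptyset$, and $ES_i(m)=\{b_j : a_i\succ_{b_j}m(b_j)\}\cup\{m(a_i)\}$ otherwise (with $\{m(a_i)\}$ omitted if $a_i$ is unmatched), and let $ES(m)=\{(a_i,b_j) : b_j\in ES_i(m)\}$ be the global envy-set of $m$. **Sampling.** During $T$ rounds each agent pulls one arm per round according to a fixed schedule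 in which each agent pulls each arm exactly $T/K$ times. All rewards are independent. The reward $X$ of a pull of $b_j$ by $a_i$ has mean $\mu_{i,j}$ and is 1-subgaussian: $\mathbb E\,e^{\lambda(X-\mu_{i,j})}\le e^{\lambda^2/2}$ for all $\lambda\in\mathbb R$. Let $\hat\mu_{i,j}$ be the average of the rewards that $a_i$ received from $b_j$, and let $\hat m_1$ and $\hat m_2$ be the matchings computed by agent-proposing and by arm-proposing deferred acceptance, respectively, when each agent ranks the arms by $\hat\mu_{i,\cdot}$ (ties broken arbitrarily) and the arms use their true preferences. **Theorem.** There are a universal constant $C>0$ and, for all $N,K$, a threshold $\tau_{N,K}$ depending only on $N$ and $K$, such that for all such markets and reward distributions and all $T$ with $\Delta^2T\ge\tau_{N,K}$: 1. if $ES(\overline m)\neq\emptyset$, then $P(\hat m_1\text{ is unstable})\le C\,|ES(\overline m)|\exp\left(-\frac{\Delta^2T}{8K}\right)$; 2. $P(\hat m_2\text{ is unstable})\le C\,|ES(\underline m)|\exp\left(-\frac{\Delta^2T}{8K}\right)$. Here "unstable" means not stable with respect to the true preferences. -/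

import Mathlib

namespace MatchingMarket

open MeasureTheory ProbabilityTheory

/-- A strict total ordering of `Fin n`, given by the position of each element; position `0` is the
most preferred one. -/
abbrev Ranking (n : ℕ) : Type := Equiv.Perm (Fin n)

/-- `r.Prefers x y`: under the ordering `r`, the outcome `x` is strictly better than `y`, where
`none` is the outcome "unmatched", worse than every partner. -/
def Ranking.Prefers {n : ℕ} (r : Ranking n) : Option (Fin n) → Option (Fin n) → Prop
  | some x, some y => r x < r y
  | some _, none => True
  | none, _ => False

instance Ranking.decidablePrefers {n : ℕ} (r : Ranking n) (x y : Option (Fin n)) :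
    Decidable (Ranking.Prefers r x y) := by
  cases x <;> cases y <;> unfold Ranking.Prefers <;> infer_instance

/-- The most preferred element of a finite set of candidates (`none` if there is none). -/
def Ranking.pick {n : ℕ} (r : Ranking n) (S : Finset (Fin n)) : Option (Fin n) :=
  (Fin.find? fun pos => decide (r.symm pos ∈ S)).map r.symm

theorem Ranking.pick_eq_some_iff {n : ℕ} (r : Ranking n) (S : Finset (Fin n)) (x : Fin n) :
    Ranking.pick r S = some x ↔ x ∈ S ∧ ∀ y ∈ S, r x ≤ r y := by
  unfold Ranking.pick
  rw [Option.map_eq_some_iff]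
  constructor
  · rintro ⟨pos, h, rfl⟩
    rw [Fin.find?_eq_some_iff] at h
    refine ⟨by simpa using h.1, fun y hy => ?_⟩
    by_contra hlt
    have := h.2 (r y) (by simpa using hlt)
    simp [hy] at this
  · rintro ⟨hx, hmin⟩
    refine ⟨r x, ?_, by simp⟩
    rw [Fin.find?_eq_some_iff]
    refine ⟨by simpa using hx, fun pos hpos => ?_⟩
    by_contra hne
    have hmem : r.symm pos ∈ S := by simpa using hne
    have := hmin _ hmem
    simp only [Equiv.apply_symm_apply] at this
    exact absurd hpos (not_lt.mpr this)

section Stability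

variable {N K : ℕ}

/-- A matching of agents `Fin N` with arms `Fin K`: `m i` is the arm of agent `i`, `m.symm j` the
agent of arm `j` (`none` means unmatched). -/
abbrev Matching (N K : ℕ) : Type := Fin N ≃. Fin K

/-- Agent `i` and arm `j` strictly prefer each other to their partners in `m`. -/
def IsBlockingPair (agentPref : Fin N → Ranking K) (armPref : Fin K → Ranking N)
    (m : Matching N K) (i : Fin N) (j : Fin K) : Prop :=
  (agentPref i).Prefers (some j) (m i) ∧ (armPref j).Prefers (some i) (m.symm j)

def IsStable (agentPref : Fin N → Ranking K) (armPref : Fin K → Ranking N)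
    (m : Matching N K) : Prop :=
  ∀ i j, ¬ IsBlockingPair agentPref armPref m i j

/-- `m` is stable and no agent prefers another stable matching to it. -/
def IsAgentOptimalStable (agentPref : Fin N → Ranking K) (armPref : Fin K → Ranking N)
    (m : Matching N K) : Prop :=
  IsStable agentPref armPref m ∧
    ∀ m' : Matching N K, IsStable agentPref armPref m' →
      ∀ i, ¬ (agentPref i).Prefers (m' i) (m i)

/-- `m` is stable and no agent prefers it to another stable matching. -/
def IsAgentPessimalStable (agentPref : Fin N → Ranking K) (armPref : Fin K → Ranking N)
    (m : Matching N K) : Prop :=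
  IsStable agentPref armPref m ∧
    ∀ m' : Matching N K, IsStable agentPref armPref m' →
      ∀ i, ¬ (agentPref i).Prefers (m i) (m' i)

/-- The arms that prefer agent `i` to their partner in `m`. -/
def enviedArms (armPref : Fin K → Ranking N) (m : Matching N K) (i : Fin N) : Finset (Fin K) :=
  Finset.univ.filter fun j => (armPref j).Prefers (some i) (m.symm j)

/-- The local envy-set of agent `i`. -/
def localEnvySet (armPref : Fin K → Ranking N) (m : Matching N K) (i : Fin N) :
    Finset (Fin K) :=
  if enviedArms armPref m i = ∅ then ∅ else enviedArms armPref m i ∪ (m i).toFinset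

/-- The global envy-set `ES(m)`. -/
def envySet (armPref : Fin K → Ranking N) (m : Matching N K) : Finset (Fin N × Fin K) :=
  Finset.univ.filter fun p => p.2 ∈ localEnvySet armPref m p.1

end Stability

/-! Deferred acceptance with proposers `Fin n` and receivers `Fin k`. The state of the algorithm
is, for each proposer, the set of receivers that have rejected it so far. -/
section DeferredAcceptance

variable {n k : ℕ}

/-- Each proposer proposes to its favourite among the receivers that have not rejected it. -/
def proposal (propPref : Fin n → Ranking k) (rej : Fin n → Finset (Fin k)) (p : Fin n) :
    Option (Fin k) :=
  (propPref p).pick (rej p)ᶜ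

/-- Each receiver tentatively holds its favourite among the current proposals. -/
def held (propPref : Fin n → Ranking k) (recPref : Fin k → Ranking n)
    (rej : Fin n → Finset (Fin k)) (r : Fin k) : Option (Fin n) :=
  (recPref r).pick (Finset.univ.filter fun p => proposal propPref rej p = some r)

/-- One round: the proposals that are not held get rejected. -/
def daStep (propPref : Fin n → Ranking k) (recPref : Fin k → Ranking n)
    (rej : Fin n → Finset (Fin k)) (p : Fin n) : Finset (Fin k) :=
  rej p ∪ Finset.univ.filter fun r =>
    proposal propPref rej p = some r ∧ held propPref recPref rej r ≠ some p

/-- The state after `n * k` rounds. Every round before the process stops produces a new rejection,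
so that by then it has stopped. -/
def daFinal (propPref : Fin n → Ranking k) (recPref : Fin k → Ranking n) :
    Fin n → Finset (Fin k) :=
  (daStep propPref recPref)^[n * k] fun _ => ∅

/-- The matching computed by deferred acceptance: each receiver gets the proposer it holds. -/
def deferredAcceptance (propPref : Fin n → Ranking k) (recPref : Fin k → Ranking n) :
    Fin n ≃. Fin k where
  toFun p := (proposal propPref (daFinal propPref recPref) p).filter fun r =>
    decide (held propPref recPref (daFinal propPref recPref) r = some p)
  invFun r := held propPref recPref (daFinal propPref recPref) r
  inv p r := by
    simp only [Option.filter_eq_some_iff, decide_eq_true_eq]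
    refine ⟨fun h => ⟨?_, h⟩, fun h => h.2⟩
    have := ((Ranking.pick_eq_some_iff _ _ _).1 h).1
    simpa using this

/-- Agent-proposing deferred acceptance. -/
def agentDA {N K : ℕ} (agentPref : Fin N → Ranking K) (armPref : Fin K → Ranking N) :
    Matching N K :=
  deferredAcceptance agentPref armPref

/-- Arm-proposing deferred acceptance. -/
def armDA {N K : ℕ} (agentPref : Fin N → Ranking K) (armPref : Fin K → Ranking N) :
    Matching N K :=
  (deferredAcceptance armPref agentPref).symm

end DeferredAcceptance

section Sampling

variable {N K T : ℕ}

/-- The utilities `μ` represent the (strict) preferences of the agents. -/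
def Represents (μ : Fin N → Fin K → ℝ) (agentPref : Fin N → Ranking K) : Prop :=
  ∀ i j k, (agentPref i).Prefers (some j) (some k) ↔ μ i k < μ i j

/-- The strict preferences `agentPref` are ordered by the utilities `u`, with ties in `u` (if any)
broken in some way. -/
def Refines (agentPref : Fin N → Ranking K) (u : Fin N → Fin K → ℝ) : Prop :=
  ∀ i j k, u i k < u i j → (agentPref i).Prefers (some j) (some k)

/-- The minimum preference gap `Δ`. -/
noncomputable def minGap (μ : Fin N → Fin K → ℝ) : ℝ :=
  sInf {d : ℝ | ∃ (i : Fin N) (j k : Fin K), j ≠ k ∧ d = |μ i j - μ i k|}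

/-- Uniform sampling over `T` rounds: in round `t` agent `i` pulls the arm `pull i t` and receives
the reward `X i t`. Each agent pulls each arm `T / K` times, and the rewards are independent and
1-subgaussian around the utility of the pulled arm (variance proxy `1`). -/
structure IsUniformSampling {Ω : Type*} [MeasurableSpace Ω] (P : Measure Ω)
    (μ : Fin N → Fin K → ℝ) (pull : Fin N → Fin T → Fin K) (X : Fin N → Fin T → Ω → ℝ) :
    Prop where
  uniform : ∀ i j, K * (Finset.univ.filter fun t => pull i t = j).card = T
  measurable : ∀ i t, Measurable (X i t)
  indep : iIndepFun (fun p : Fin N × Fin T => X p.1 p.2) P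
  mean : ∀ i t, ∫ ω, X i t ω ∂P = μ i (pull i t)
  subgaussian : ∀ i t, HasSubgaussianMGF (fun ω => X i t ω - μ i (pull i t)) 1 P

/-- The average of the rewards that agent `i` received from arm `j`. -/
noncomputable def sampleMean {Ω : Type*} (pull : Fin N → Fin T → Fin K)
    (X : Fin N → Fin T → Ω → ℝ) (ω : Ω) (i : Fin N) (j : Fin K) : ℝ :=
  (∑ t ∈ Finset.univ.filter (fun t => pull i t = j), X i t ω) /
    ((Finset.univ.filter fun t => pull i t = j).card : ℝ)

end Sampling

end MatchingMarket

namespace MatchingMarket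

open MeasureTheory ProbabilityTheory

/-! ### Stability of deferred acceptance -/

section DeferredAcceptanceStability

variable {n k : ℕ}

/-! If the sample means rank no pair of arms wrongly, the estimated rankings are the true ones and
both algorithms are stable by Gale–Shapley (`deferredAcceptance_isStable`). With `T / K` pulls per
arm, a fixed pair is misranked with probability at most `exp(-Δ²T/(4K))`, and a union bound costs a
factor `N K²` (`measureReal_exists_misranked_le`). The target exponent is half as large, so once
`Δ²T` passes the threshold the other half absorbs this factor. A nonempty envy-set contributes a
factor at least `1`, so `C = 1` suffices.

If the envy-set is empty, the second bound is zero and chance cannot enter: every arm already has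
its favourite agent, these favourites are distinct, and arm-proposing deferred acceptance returns
them whatever the agents' estimates (`armDA_isStable_of_envySet_eq_empty`). -/

theorem Ranking.pick_isSome {r : Ranking n} {S : Finset (Fin n)} {x : Fin n} (hx : x ∈ S) :
    ∃ y, r.pick S = some y ∧ y ∈ S ∧ r y ≤ r x := by
  obtain ⟨y, hy, hmin⟩ := S.exists_min_image r ⟨x, hx⟩
  exact ⟨y, (Ranking.pick_eq_some_iff _ _ _).2 ⟨hy, hmin⟩, hy, hmin x hx⟩

theorem IsStable.symm {agentPref : Fin n → Ranking k} {armPref : Fin k → Ranking n}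
    {m : Matching n k} (h : IsStable agentPref armPref m) :
    IsStable armPref agentPref m.symm :=
  fun j i hb => h i j ⟨hb.2, hb.1⟩

variable {propPref : Fin n → Ranking k} {recPref : Fin k → Ranking n}
  {rej : Fin n → Finset (Fin k)}

theorem exists_held_of_proposal {p : Fin n} {r : Fin k}
    (h : proposal propPref rej p = some r) :
    ∃ q, held propPref recPref rej r = some q ∧ proposal propPref rej q = some r ∧
      recPref r q ≤ recPref r p := by
  obtain ⟨q, hq, hmem, hle⟩ := Ranking.pick_isSome (r := recPref r)
    (S := Finset.univ.filter fun p => proposal propPref rej p = some r) (x := p) (by simpa using h)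
  exact ⟨q, hq, by simpa using hmem, hle⟩

theorem proposal_daStep_of_held {q : Fin n} {r : Fin k}
    (hp : proposal propPref rej q = some r) (hh : held propPref recPref rej r = some q) :
    proposal propPref (daStep propPref recPref rej) q = some r := by
  have : daStep propPref recPref rej q = rej q := by
    ext s
    simp only [daStep, Finset.mem_union, Finset.mem_filter, Finset.mem_univ, true_and, hp]
    constructor
    · rintro (h | ⟨h, h'⟩)
      · exact h
      · cases h
        exact absurd hh h'
    · exact Or.inl
  simpa [proposal, this] using hp

/-- Every receiver that has rejected a proposer currently has a better proposal. -/
def RejectionsJustified (propPref : Fin n → Ranking k) (recPref : Fin k → Ranking n)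
    (rej : Fin n → Finset (Fin k)) : Prop :=
  ∀ p, ∀ r ∈ rej p, ∃ q, proposal propPref rej q = some r ∧ recPref r q < recPref r p

/-- Receivers only trade up: the held proposer repeats its proposal in the next round, and it is at
least as good as any current proposer. -/
theorem RejectionsJustified.daStep (h : RejectionsJustified propPref recPref rej) :
    RejectionsJustified propPref recPref (daStep propPref recPref rej) := by
  intro p r hr
  simp only [MatchingMarket.daStep, Finset.mem_union, Finset.mem_filter, Finset.mem_univ,
    true_and] at hr
  rcases hr with hr | ⟨hp, hne⟩
  · obtain ⟨p', hp', hlt⟩ := h p r hr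
    obtain ⟨q, hq, hqr, hle⟩ := exists_held_of_proposal (recPref := recPref) hp'
    exact ⟨q, proposal_daStep_of_held hqr hq, hle.trans_lt hlt⟩
  · obtain ⟨q, hq, hqr, hle⟩ := exists_held_of_proposal (recPref := recPref) hp
    refine ⟨q, proposal_daStep_of_held hqr hq, lt_of_le_of_ne hle fun he => hne ?_⟩
    rw [hq, (recPref r).injective he]

theorem rejectionsJustified_daFinal :
    RejectionsJustified propPref recPref (daFinal propPref recPref) := by
  unfold daFinal
  induction n * k with
  | zero => intro p r hr; simp at hr
  | succ t ih => rw [Function.iterate_succ_apply']; exact ih.daStep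

theorem le_daStep (rej : Fin n → Finset (Fin k)) : rej ≤ daStep propPref recPref rej :=
  fun _ => Finset.subset_union_left

/-- An idle round would make all later rounds idle, so an active round has only active rounds before
it, each adding at least one rejection. -/
theorem le_sum_card_iterate_daStep (t : ℕ)
    (hne : daStep propPref recPref ((daStep propPref recPref)^[t] fun _ => ∅) ≠
      (daStep propPref recPref)^[t] fun _ => ∅) :
    t + 1 ≤ ∑ p, ((daStep propPref recPref)^[t + 1] (fun _ => ∅) p).card := by
  have hlt : ∀ s : Fin n → Finset (Fin k), daStep propPref recPref s ≠ s →
      ∑ p, (s p).card < ∑ p, (daStep propPref recPref s p).card := by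
    intro s hs
    obtain ⟨p, hp⟩ := Function.ne_iff.1 hs
    exact Finset.sum_lt_sum (fun q _ => Finset.card_le_card (le_daStep s q))
      ⟨p, Finset.mem_univ _,
        Finset.card_lt_card (lt_of_le_of_ne (le_daStep s p) (Ne.symm hp))⟩
  induction t with
  | zero => exact Nat.succ_le_of_lt ((Nat.zero_le _).trans_lt (hlt _ hne))
  | succ t ih =>
    have h := hlt _ hne
    simp only [← Function.iterate_succ_apply' (daStep propPref recPref), Nat.succ_eq_add_one] at h
    have := ih fun he => hne <| by rw [Function.iterate_succ_apply', he, he]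
    omega

theorem daStep_daFinal :
    daStep propPref recPref (daFinal propPref recPref) = daFinal propPref recPref := by
  by_contra hne
  -- Another active round would give `n * k + 1` rejections among only `n * k` pairs.
  have h := le_sum_card_iterate_daStep (n * k) hne
  have hle : ∑ p, ((daStep propPref recPref)^[n * k + 1] (fun _ => ∅) p).card ≤
      ∑ _p : Fin n, k :=
    Finset.sum_le_sum fun p _ => (Finset.card_le_univ _).trans_eq (Fintype.card_fin k)
  rw [Finset.sum_const, Finset.card_univ, Fintype.card_fin, smul_eq_mul] at hle
  exact absurd (h.trans hle) (Nat.not_succ_le_self _)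

theorem held_daFinal_of_proposal {p : Fin n} {r : Fin k}
    (h : proposal propPref (daFinal propPref recPref) p = some r) :
    held propPref recPref (daFinal propPref recPref) r = some p := by
  by_contra hne
  have hmem : r ∈ daStep propPref recPref (daFinal propPref recPref) p := by
    simp [daStep, h, hne]
  rw [daStep_daFinal] at hmem
  have := ((Ranking.pick_eq_some_iff _ _ _).1 h).1
  simp [hmem] at this

theorem deferredAcceptance_apply (p : Fin n) :
    deferredAcceptance propPref recPref p =
      proposal propPref (daFinal propPref recPref) p := by
  change (proposal propPref (daFinal propPref recPref) p).filter _ = _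
  cases h : proposal propPref (daFinal propPref recPref) p with
  | none => rfl
  | some r => simp [Option.filter, held_daFinal_of_proposal h]

/-- A receiver that rejected the proposer holds someone better; one that did not is no better for
the proposer than its final proposal. -/
theorem deferredAcceptance_isStable (propPref : Fin n → Ranking k) (recPref : Fin k → Ranking n) :
    IsStable propPref recPref (deferredAcceptance propPref recPref) := by
  rintro p r ⟨hp, hr⟩
  rw [deferredAcceptance_apply] at hp
  change (recPref r).Prefers (some p) (held propPref recPref (daFinal propPref recPref) r) at hr
  by_cases hmem : r ∈ daFinal propPref recPref p
  · obtain ⟨q, hq, hlt⟩ := rejectionsJustified_daFinal p r hmem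
    rw [held_daFinal_of_proposal hq] at hr
    exact lt_asymm hr hlt
  · obtain ⟨s, hs, -, hle⟩ := Ranking.pick_isSome (r := propPref p)
      (S := (daFinal propPref recPref p)ᶜ) (x := r) (by simpa using hmem)
    rw [show proposal propPref (daFinal propPref recPref) p = some s from hs] at hp
    exact (not_lt.2 hle) hp

end DeferredAcceptanceStability

/-! ### Empty envy-set -/

section EnvyFree

variable {N K : ℕ}

theorem not_prefers_of_envySet_eq_empty {armPref : Fin K → Ranking N} {m : Matching N K}
    (h : envySet armPref m = ∅) (i : Fin N) (j : Fin K) :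
    ¬ (armPref j).Prefers (some i) (m.symm j) := by
  intro hp
  have hj : j ∈ enviedArms armPref m i := by simpa [enviedArms] using hp
  have : (i, j) ∈ envySet armPref m := by
    rw [envySet, Finset.mem_filter, localEnvySet, if_neg (Finset.ne_empty_of_mem hj)]
    exact ⟨Finset.mem_univ _, Finset.mem_union_left _ hj⟩
  simp [h] at this

/-- If some matching gives every arm its favourite agent, then arm-proposing deferred acceptance
stops at once. -/
theorem daFinal_eq_empty_of_envySet_eq_empty {armPref : Fin K → Ranking N} {m : Matching N K}
    (h : envySet armPref m = ∅) (recPref : Fin N → Ranking K) :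
    daFinal armPref recPref = fun _ => ∅ := by
  have hm : ∀ j i, proposal armPref (fun _ => ∅) j = some i → m.symm j = some i := by
    intro j i hji
    have hmin := ((Ranking.pick_eq_some_iff _ _ _).1 hji).2
    have hn := not_prefers_of_envySet_eq_empty h i j
    cases hj : m.symm j with
    | none => simp [hj, Ranking.Prefers] at hn
    | some a =>
      have hle : armPref j a ≤ armPref j i := by simpa [hj, Ranking.Prefers] using hn
      rw [(armPref j).injective (le_antisymm hle (hmin a (by simp)))]
  refine Function.iterate_fixed ?_ _
  funext j
  refine Finset.eq_empty_of_forall_notMem fun i hi => ?_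
  simp only [daStep, Finset.mem_union, Finset.mem_filter, Finset.mem_univ, true_and,
    Finset.notMem_empty, false_or] at hi
  obtain ⟨j', hh, hj', -⟩ := exists_held_of_proposal (recPref := recPref) hi.1
  -- Both arms propose to `i`, so `m` matches both to `i`; hence they coincide and no proposal is
  -- ever rejected.
  rw [m.symm.inj (hm j' i hj') (hm j i hi.1)] at hh
  exact hi.2 hh

theorem armDA_isStable_of_envySet_eq_empty {armPref : Fin K → Ranking N} {m : Matching N K}
    (h : envySet armPref m = ∅) (agentPref estPref : Fin N → Ranking K) :
    IsStable agentPref armPref (armDA estPref armPref) := by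
  rintro i j ⟨-, hb⟩
  change (armPref j).Prefers (some i) (deferredAcceptance armPref estPref j) at hb
  obtain ⟨a, ha, -, hle⟩ := Ranking.pick_isSome (r := armPref j) (S := (∅ : Finset (Fin N))ᶜ)
    (x := i) (by simp)
  rw [deferredAcceptance_apply, daFinal_eq_empty_of_envySet_eq_empty h] at hb
  rw [show proposal armPref (fun _ => ∅) j = some a from ha] at hb
  exact (not_lt.2 hle) hb

end EnvyFree

/-! ### Concentration of the sample means -/

section Concentration

variable {N K T : ℕ} {Ω : Type*} [MeasurableSpace Ω] {P : Measure Ω}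
  {μ : Fin N → Fin K → ℝ} {pull : Fin N → Fin T → Fin K} {X : Fin N → Fin T → Ω → ℝ}

theorem eq_of_refines_sampleMean {agentPref estPref : Fin N → Ranking K}
    {u : Fin N → Fin K → ℝ} (hμ : Represents μ agentPref) (hu : Refines estPref u)
    (h : ∀ i j k, μ i k < μ i j → u i k < u i j) : estPref = agentPref := by
  funext i
  have hmono : StrictMono fun x => estPref i ((agentPref i).symm x) := by
    intro x y hxy
    refine hu i _ _ (h i _ _ ((hμ i _ _).1 ?_))
    simpa [Ranking.Prefers] using hxy
  -- A strictly increasing surjection of `Fin K` onto itself is the identity.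
  have := (StrictMono.range_inj hmono strictMono_id).1 (by
    rw [Set.range_id]
    exact ((agentPref i).symm.trans (estPref i)).surjective.range_eq)
  ext x
  have h := congrFun this (agentPref i x)
  simp only [Equiv.symm_apply_apply, id] at h
  rw [h]

theorem minGap_nonneg (μ : Fin N → Fin K → ℝ) : 0 ≤ minGap μ :=
  Real.sInf_nonneg (by rintro _ ⟨i, j, k, -, rfl⟩; exact abs_nonneg _)

theorem minGap_le (μ : Fin N → Fin K → ℝ) (i : Fin N) {j k : Fin K} (h : j ≠ k) :
    minGap μ ≤ |μ i j - μ i k| :=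
  csInf_le ⟨0, by rintro _ ⟨i, j, k, -, rfl⟩; exact abs_nonneg _⟩ ⟨i, j, k, h, rfl⟩

/-- With `c = T / K` pulls per arm, misranking forces a sum of `2c` independent centred
1-subgaussian terms to reach `c` times the gap `g`, giving `exp(-(c g)² / (4c)) = exp(-c g² / 4)`.
-/
theorem IsUniformSampling.measureReal_sampleMean_le [IsProbabilityMeasure P]
    (hS : IsUniformSampling P μ pull X) (i : Fin N) {j k : Fin K} (hlt : μ i k < μ i j) :
    P.real {ω | sampleMean pull X ω i j ≤ sampleMean pull X ω i k} ≤
      Real.exp (-((μ i j - μ i k) ^ 2 * T / (4 * K))) := by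
  have hjk : j ≠ k := by rintro rfl; exact lt_irrefl _ hlt
  have hK : 0 < K := Fin.pos j
  rcases Nat.eq_zero_or_pos T with rfl | hT
  · simp
  set A := fun l => Finset.univ.filter fun t => pull i t = l with hA
  obtain ⟨c, hc⟩ : ∃ c, (A j).card = c := ⟨_, rfl⟩
  have hcT : K * c = T := hc ▸ hS.uniform i j
  have hck : (A k).card = c := Nat.eq_of_mul_eq_mul_left hK ((hS.uniform i k).trans hcT.symm)
  have hc0 : 0 < c := by
    rcases Nat.eq_zero_or_pos c with rfl | h
    · omega
    · exact h
  have hcR : (0 : ℝ) < c := by exact_mod_cast hc0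
  have hKR : (0 : ℝ) < K := by exact_mod_cast hK
  have hdisj : Disjoint (A k) (A j) := by
    rw [Finset.disjoint_left]
    intro t h1 h2
    simp only [hA, Finset.mem_filter, Finset.mem_univ, true_and] at h1 h2
    exact hjk (h2.symm.trans h1)
  -- The signs turn the difference of the two arms' reward sums into a single sum; negation
  -- preserves subgaussianity.
  set s : Fin T → ℝ := fun t => if pull i t = k then 1 else -1 with hs
  have hind : iIndepFun (fun t ω => s t * (X i t ω - μ i (pull i t))) P :=
    (hS.indep.precomp (g := fun t : Fin T => (i, t)) fun _ _ h => (Prod.mk.inj h).2).comp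
      (fun t x => s t * (x - μ i (pull i t))) fun t => by fun_prop
  have hsub : ∀ t, HasSubgaussianMGF (fun ω => s t * (X i t ω - μ i (pull i t))) 1 P := by
    intro t
    by_cases h : pull i t = k
    · simpa [hs, h] using hS.subgaussian i t
    · simpa [hs, h, Pi.neg_def] using (hS.subgaussian i t).neg
  have hcard : (A k ∪ A j).card = 2 * c := by
    rw [Finset.card_union_of_disjoint hdisj, hc, hck, two_mul]
  have htail := HasSubgaussianMGF.measure_sum_ge_le_of_iIndepFun hind
    (s := A k ∪ A j) (c := fun _ => 1) (fun t _ => hsub t)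
    (ε := c * (μ i j - μ i k)) (mul_nonneg hcR.le (sub_nonneg.2 hlt.le))
  refine (measureReal_mono fun ω hω => ?_).trans (htail.trans_eq ?_)
  · simp only [Set.mem_ofPred_eq] at hω ⊢
    have hle : ∑ t ∈ A j, X i t ω ≤ ∑ t ∈ A k, X i t ω := by
      change (∑ t ∈ A j, X i t ω) / ((A j).card : ℝ) ≤
        (∑ t ∈ A k, X i t ω) / ((A k).card : ℝ) at hω
      rw [hc, hck] at hω
      exact (div_le_div_iff_of_pos_right hcR).1 hω
    rw [Finset.sum_union hdisj]
    have h1 : ∑ t ∈ A k, s t * (X i t ω - μ i (pull i t)) =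
        ∑ t ∈ A k, X i t ω - c * μ i k := by
      rw [← hck, ← nsmul_eq_mul, ← Finset.sum_const, ← Finset.sum_sub_distrib]
      refine Finset.sum_congr rfl fun t ht => ?_
      have : pull i t = k := by simpa [hA] using ht
      simp [hs, this]
    have h2 : ∑ t ∈ A j, s t * (X i t ω - μ i (pull i t)) =
        c * μ i j - ∑ t ∈ A j, X i t ω := by
      rw [← hc, ← nsmul_eq_mul, ← Finset.sum_const, ← Finset.sum_sub_distrib]
      refine Finset.sum_congr rfl fun t ht => ?_
      have : pull i t = j := by simpa [hA] using ht
      simp [hs, this, hjk]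
    rw [h1, h2]
    linarith
  · congr 1
    simp only [Finset.sum_const, hcard, nsmul_eq_mul, mul_one]
    rw [← hcT]
    push_cast
    field_simp
    ring

/-- Misranking some pair of arms is unlikely. -/
theorem IsUniformSampling.measureReal_exists_misranked_le [IsProbabilityMeasure P]
    (hS : IsUniformSampling P μ pull X) :
    P.real {ω | ∃ i j k, μ i k < μ i j ∧
        sampleMean pull X ω i j ≤ sampleMean pull X ω i k} ≤
      (N * K ^ 2 : ℝ) * Real.exp (-(minGap μ ^ 2 * T / (4 * K))) := by
  have hsub : {ω | ∃ i j k, μ i k < μ i j ∧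
        sampleMean pull X ω i j ≤ sampleMean pull X ω i k} ⊆
      ⋃ p : Fin N × Fin K × Fin K, {ω | μ p.1 p.2.2 < μ p.1 p.2.1 ∧
        sampleMean pull X ω p.1 p.2.1 ≤ sampleMean pull X ω p.1 p.2.2} := by
    rintro ω ⟨i, j, k, h⟩
    exact Set.mem_iUnion.2 ⟨(i, j, k), h⟩
  refine (measureReal_mono hsub).trans ((measureReal_iUnion_fintype_le _).trans ?_)
  refine (Finset.sum_le_card_nsmul _ _ (Real.exp (-(minGap μ ^ 2 * T / (4 * K)))) ?_).trans_eq ?_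
  · rintro ⟨i, j, k⟩ -
    by_cases hlt : μ i k < μ i j
    · simp only [hlt, true_and]
      refine (hS.measureReal_sampleMean_le i hlt).trans (Real.exp_le_exp.2 (neg_le_neg ?_))
      have hjk : j ≠ k := by rintro rfl; exact lt_irrefl _ hlt
      have hgap := minGap_le μ i hjk
      rw [abs_of_pos (sub_pos.2 hlt)] at hgap
      have := minGap_nonneg μ
      gcongr
    · simp only [hlt, false_and, Set.ofPred_false, measureReal_empty]
      positivity
  · rw [Finset.card_univ, nsmul_eq_mul]
    simp only [Fintype.card_prod, Fintype.card_fin]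
    push_cast
    ring

/-- Beyond the threshold, half of the exponent absorbs the number of pairs of arms. -/
theorem mul_exp_le_exp_of_threshold {N K : ℕ} {x : ℝ}
    (h : 8 * K * Real.log (N * K ^ 2 + 1) ≤ x) :
    (N * K ^ 2 : ℝ) * Real.exp (-(x / (4 * K))) ≤ Real.exp (-(x / (8 * K))) := by
  rcases Nat.eq_zero_or_pos K with rfl | hK
  · simp
  have hKR : (0 : ℝ) < K := by exact_mod_cast hK
  have hlog : Real.log (N * K ^ 2 + 1) ≤ x / (8 * K) := by
    rw [le_div_iff₀ (by positivity)]
    linarith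
  have hle : (N * K ^ 2 : ℝ) ≤ Real.exp (x / (8 * K)) := by
    have := (Real.log_le_iff_le_exp (by positivity)).1 hlog
    linarith
  calc (N * K ^ 2 : ℝ) * Real.exp (-(x / (4 * K)))
      ≤ Real.exp (x / (8 * K)) * Real.exp (-(x / (4 * K))) := by gcongr
    _ = Real.exp (-(x / (8 * K))) := by
      rw [← Real.exp_add]
      congr 1
      field_simp
      ring

end Concentration

end MatchingMarket

/-! ### The two instability bounds -/

theorem mainTheorem2 :
    ∃ C : ℝ, 0 < C ∧ ∀ N K : ℕ, ∃ τ : ℝ,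
      ∀ (agentPref : Fin N → MatchingMarket.Ranking K)
        (armPref : Fin K → MatchingMarket.Ranking N)
        (μ : Fin N → Fin K → ℝ), MatchingMarket.Represents μ agentPref →
      ∀ mOpt mPes : MatchingMarket.Matching N K,
        MatchingMarket.IsAgentOptimalStable agentPref armPref mOpt →
        MatchingMarket.IsAgentPessimalStable agentPref armPref mPes →
      ∀ T : ℕ, τ ≤ MatchingMarket.minGap μ ^ 2 * T →
      ∀ (Ω : Type*) [MeasurableSpace Ω] (P : MeasureTheory.Measure Ω)
        [MeasureTheory.IsProbabilityMeasure P]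
        (pull : Fin N → Fin T → Fin K) (X : Fin N → Fin T → Ω → ℝ),
        MatchingMarket.IsUniformSampling P μ pull X →
      ∀ estPref : Ω → Fin N → MatchingMarket.Ranking K,
        (∀ ω, MatchingMarket.Refines (estPref ω) (MatchingMarket.sampleMean pull X ω)) →
        ((MatchingMarket.envySet armPref mOpt).Nonempty →
          P.real {ω | ¬ MatchingMarket.IsStable agentPref armPref
              (MatchingMarket.agentDA (estPref ω) armPref)} ≤
            C * ((MatchingMarket.envySet armPref mOpt).card *
              Real.exp (-(MatchingMarket.minGap μ ^ 2 * T / (8 * K))))) ∧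
        P.real {ω | ¬ MatchingMarket.IsStable agentPref armPref
            (MatchingMarket.armDA (estPref ω) armPref)} ≤
          C * ((MatchingMarket.envySet armPref mPes).card *
            Real.exp (-(MatchingMarket.minGap μ ^ 2 * T / (8 * K)))) := by
  refine ⟨1, one_pos, fun N K => ⟨8 * K * Real.log (N * K ^ 2 + 1), ?_⟩⟩
  intro agentPref armPref μ hμ mOpt mPes _ _ T hT Ω _ P _ pull X hS estPref hest
  -- Common to both bounds: an event that never occurs under correct rankings lies inside the
  -- misranking event.
  have key : ∀ S : Finset (Fin N × Fin K), S.Nonempty → ∀ E : Set Ω,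
      (∀ ω, estPref ω = agentPref → ω ∉ E) →
      P.real E ≤ 1 * (S.card * Real.exp (-(MatchingMarket.minGap μ ^ 2 * T / (8 * K)))) := by
    intro S hne E hE
    have hsub : E ⊆ {ω | ∃ i j k, μ i k < μ i j ∧
        MatchingMarket.sampleMean pull X ω i j ≤ MatchingMarket.sampleMean pull X ω i k} := by
      intro ω hω
      by_contra hgood
      simp only [Set.mem_ofPred_eq, not_exists, not_and, not_le] at hgood
      exact hE ω (MatchingMarket.eq_of_refines_sampleMean hμ (hest ω) hgood) hω
    have hcard : (1 : ℝ) ≤ S.card := by exact_mod_cast hne.card_pos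
    rw [one_mul]
    exact (MeasureTheory.measureReal_mono hsub).trans <|
      hS.measureReal_exists_misranked_le.trans <|
      (MatchingMarket.mul_exp_le_exp_of_threshold hT).trans <|
      le_mul_of_one_le_left (Real.exp_nonneg _) hcard
  refine ⟨fun hne => key _ hne _ fun ω h => ?_, ?_⟩
  · simpa [h, MatchingMarket.agentDA] using
      MatchingMarket.deferredAcceptance_isStable agentPref armPref
  · rcases (MatchingMarket.envySet armPref mPes).eq_empty_or_nonempty with he | hne
    · simp [he, MatchingMarket.armDA_isStable_of_envySet_eq_empty he]
    · refine key _ hne _ fun ω h => ?_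
      simpa [h, MatchingMarket.armDA] using
        (MatchingMarket.deferredAcceptance_isStable armPref agentPref).symm
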